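/- For $z\in\mathbb{C}$ let $\mathrm{ReLU}(z)=\max(0,\Re z)+\mathrm{i}\max(0,\Im z)$; applied to a vector of $\mathbb{C}^n$, it acts on each coordinate. A deep ReLU network of width $n$ and depth $L$ is a function $\mathcal{N}=f_L\circ\cdots\circ f_1:\mathbb{C}^n\to\mathbb{C}^n$ with $f_i(x)=\mathrm{ReLU}(W_ix+b_i)$, where $W_i\in\mathbb{C}^{n\times n}$ and $b_i\in\mathbb{C}^n$ are arbitrary. A diagonal circulant neural network (DCNN) of width $n$ and depth $m$ is a function $g_m\circ\cdots\circ g_1:\mathbb{C}^n\to\mathbb{C}^n$ with $g_i(x)=\phi_i(D_iC_ix+b_i)$, where $D_i\in\mathbb{C}^{n\times n}$ is diagonal, $C_i\in\mathbb{C}^{n\times n}$ is circulant (its $(j,k)$ entry depends only on $j-k$ modulo $n$), $b_i\in\mathbb{C}^n$, and each $\phi_i$ is either $\mathrm{ReLU}$ or the identity. (A network of depth $0$ is the identity map.) Let $n\ge 1$ and $L\ge 0$ be integers, let $\mathcal{N}$ be a deep ReLU network of width $n$ and depth $L$, and let $\mathcal{X}\subset\mathbb{C}^n$ be a bounded set.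 For every $\epsilon>0$ there exists a DCNN $\mathcal{N}'$ of width $n$ and of depth $(2n-1)L$ such that $\|\mathcal{N}(x)-\mathcal{N}'(x)\|<\epsilon$ for all $x\in\mathcal{X}$, where $\|\cdot\|$ is the $\ell_2$ norm. -/

import Mathlib

namespace DCNN

/-- Vectors of `ℂⁿ` with the `ℓ²` norm. -/
abbrev Vec (n : ℕ) : Type := EuclideanSpace ℂ (Fin n)

/-- The ReLU function on the complex domain: `max 0 (Re z) + i max 0 (Im z)`. -/
noncomputable def cReLU (z : ℂ) : ℂ := ⟨max 0 z.re, max 0 z.im⟩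

/-- The layer `x ↦ φ (W x + b)`, the activation `φ` being applied to each coordinate. -/
noncomputable def layer {n : ℕ} (φ : ℂ → ℂ) (W : Matrix (Fin n) (Fin n) ℂ) (b : Vec n)
    (x : Vec n) : Vec n :=
  WithLp.toLp 2 (fun t => φ ((W.mulVec (WithLp.ofLp x)) t + b t))

/-- `compLayers L f` is the composition `f_L ∘ ⋯ ∘ f_1` (the layer of index `0` is applied first;
for `L = 0` it is the identity). -/
def compLayers {E : Type*} : (L : ℕ) → (Fin L → E → E) → E → E
  | 0, _ => id
  | L + 1, f => f (Fin.last L) ∘ compLayers L (fun i => f i.castSucc)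

/-- `N` is a deep ReLU network of width `n` and depth `L`. -/
def IsDeepReLUNetwork {n : ℕ} (L : ℕ) (N : Vec n → Vec n) : Prop :=
  ∃ (W : Fin L → Matrix (Fin n) (Fin n) ℂ) (b : Fin L → Vec n),
    N = compLayers L (fun i => layer cReLU (W i) (b i))

/-- A circulant matrix: its `(i, j)` entry is `c (i - j)`, indices being taken modulo `n`. -/
def IsCirculant {n : ℕ} (C : Matrix (Fin n) (Fin n) ℂ) : Prop :=
  ∃ c : Fin n → ℂ, C = Matrix.circulant c

/-- `N` is a diagonal circulant neural network of width `n` and depth `L`: the weight matrix of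
each layer is the product of a diagonal matrix and a circulant matrix, and the activation of each
layer is either ReLU or the identity. -/
def IsDCNN {n : ℕ} (L : ℕ) (N : Vec n → Vec n) : Prop :=
  ∃ (D C : Fin L → Matrix (Fin n) (Fin n) ℂ) (b : Fin L → Vec n) (φ : Fin L → ℂ → ℂ),
    (∀ i, (D i).IsDiag) ∧ (∀ i, IsCirculant (C i)) ∧ (∀ i, φ i = cReLU ∨ φ i = id) ∧
      N = compLayers L (fun i => layer (φ i) (D i * C i) (b i))

end DCNN

/-! Products of `2 n - 1` diagonal-circulant matrices are dense in the `n × n` matrices. With `P`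
the cyclic shift, every matrix is `M = ∑ D_j P ^ j` with `j < n` and `D_j` diagonal. For nowhere
vanishing `u`, the product `M diag(u)` is divisible on the right by `P - r` as soon as `r` is a root
of each row polynomial of `M diag(u)`, that is, `u` lies in the kernel of `∑ D_j r ^ j P ^ j`. The
determinant of this pencil has a nonzero root when the extreme `D_j` are invertible
(`exists_kernel`), and small perturbations ensure the genericity needed. Each degree thus costs two
factors, a circulant and a diagonal one, and degree `0` is diagonal: `2 (n - 1) + 1` in all
(`shiftPoly_mem_closure`). For networks, each weight matrix is replaced by such a product; errors
stay controlled because ReLU is 1-Lipschitz and images of bounded sets are bounded. -/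

open Matrix Topology Filter
open scoped Pointwise

namespace DCNN

/-! ### Density of products of diagonal and circulant matrices -/

section Cyclic

variable {ι : Type*} [AddCommGroup ι] [Fintype ι] [DecidableEq ι]

/-- The products of a diagonal matrix and a circulant matrix. -/
def diagCirc (ι : Type*) [AddCommGroup ι] [Fintype ι] [DecidableEq ι] : Set (Matrix ι ι ℂ) :=
  {M | ∃ d c : ι → ℂ, M = diagonal d * circulant c}

/-- The matrix `∑_{j < m} D_j P ^ j`, where `P` is the permutation matrix of the shift by `g` and
`D_j` is the diagonal matrix with entries `d i j`. -/
def shiftPoly (g : ι) (m : ℕ) (d : ι → ℕ → ℂ) : Matrix ι ι ℂ :=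
  Matrix.of fun i l => ∑ j ∈ Finset.range m, d i j * if l = i + j • g then 1 else 0

omit [Fintype ι] in
lemma continuous_shiftPoly (g : ι) (m : ℕ) : Continuous (shiftPoly (ι := ι) g m) := by
  unfold shiftPoly
  refine continuous_matrix fun i l => ?_
  simp only [of_apply]
  fun_prop

lemma shiftPoly_mulVec (g : ι) (m : ℕ) (d : ι → ℕ → ℂ) (v : ι → ℂ) (i : ι) :
    (shiftPoly g m d *ᵥ v) i = ∑ j ∈ Finset.range m, d i j * v (i + j • g) := by
  simp only [mulVec, dotProduct, shiftPoly, of_apply, Finset.sum_mul]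
  rw [Finset.sum_comm]
  simp

lemma diagonal_mem_diagCirc (d : ι → ℂ) : diagonal d ∈ diagCirc ι :=
  ⟨d, Pi.single 0 1, by simp⟩

lemma circulant_mem_diagCirc (c : ι → ℂ) : circulant c ∈ diagCirc ι :=
  ⟨fun _ => 1, c, by simp⟩

/-- Division of a polynomial by `X - r`, tested against an arbitrary sequence `f`. -/
lemma exists_sum_eq_sum_sub_mul (r : ℂ) (m : ℕ) (e : ℕ → ℂ) :
    ∃ s : ℕ → ℂ, ∀ f : ℕ → ℂ, ∑ j ∈ Finset.range (m + 1), e j * f j =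
      ∑ j ∈ Finset.range m, s j * (f (j + 1) - r * f j) +
        (∑ j ∈ Finset.range (m + 1), e j * r ^ j) * f 0 := by
  induction m generalizing e with
  | zero => exact ⟨0, fun f => by simp⟩
  | succ m ih =>
    obtain ⟨s, hs⟩ := ih fun j => e (j + 1)
    -- Synthetic division: the new lowest quotient coefficient is the value at `r` of the polynomial
    -- with coefficients `e (j + 1)`.
    refine ⟨fun j => if j = 0 then ∑ j ∈ Finset.range (m + 1), e (j + 1) * r ^ j else s (j - 1),
      fun f => ?_⟩
    have h := hs fun j => f (j + 1)
    have h' : ∑ j ∈ Finset.range (m + 1), e (j + 1) * r ^ (j + 1) =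
        (∑ j ∈ Finset.range (m + 1), e (j + 1) * r ^ j) * r := by
      rw [Finset.sum_mul]
      exact Finset.sum_congr rfl fun j _ => by ring
    rw [Finset.sum_range_succ' _ (m + 1), Finset.sum_range_succ' (fun j => _ * (f (j + 1) - _)) m,
      Finset.sum_range_succ' (fun j => e j * r ^ j) (m + 1), h', h]
    simp only [pow_zero, zero_add, if_true, Nat.add_eq_zero_iff, one_ne_zero, and_false, if_false,
      Nat.add_sub_cancel]
    generalize ∑ j ∈ Finset.range (m + 1), e (j + 1) * r ^ j = a
    ring

/-- If each row polynomial, twisted by the nowhere vanishing vector `u`, has the root `r`, then the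
matrix is divisible on the right by `(P - r) diag(u)⁻¹`. -/
lemma exists_shiftPoly_eq_mul (g : ι) (m : ℕ) (d : ι → ℕ → ℂ) (r : ℂ) (u : ι → ℂ)
    (hu : ∀ i, u i ≠ 0)
    (h : ∀ i, ∑ j ∈ Finset.range (m + 1), d i j * r ^ j * u (i + j • g) = 0) :
    ∃ (s : ι → ℕ → ℂ) (c : ι → ℂ),
      shiftPoly g (m + 1) d = shiftPoly g m s * circulant c * diagonal fun i => (u i)⁻¹ := by
  choose s hs using fun i => exists_sum_eq_sum_sub_mul r m fun j => d i j * u (i + j • g)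
  -- This circulant is `P - r`; testing the division against the indicator of `l = i + j • g` reads
  -- off column `l`.
  refine ⟨s, fun x => (if x = -g then 1 else 0) - r * if x = 0 then 1 else 0, ?_⟩
  ext i l
  have h0 : ∑ j ∈ Finset.range (m + 1), d i j * u (i + j • g) * r ^ j = 0 := by
    rw [← h i]
    exact Finset.sum_congr rfl fun j _ => by ring
  have h1 := hs i fun j => if l = i + j • g then 1 else 0
  rw [h0, zero_mul, add_zero] at h1
  have h2 : shiftPoly g (m + 1) d i l * u l =
      ∑ j ∈ Finset.range (m + 1), d i j * u (i + j • g) * if l = i + j • g then 1 else 0 := by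
    simp only [shiftPoly, of_apply, Finset.sum_mul]
    refine Finset.sum_congr rfl fun j _ => ?_
    split_ifs with hl
    · rw [hl]; ring
    · ring
  rw [mul_diagonal, eq_mul_inv_iff_mul_eq₀ (hu l), h2, h1]
  have h3 : ∀ c : ι → ℂ, (shiftPoly g m s * circulant c) i l =
      (shiftPoly g m s *ᵥ fun x => c (x - l)) i := fun c => rfl
  rw [h3, shiftPoly_mulVec]
  refine Finset.sum_congr rfl fun j _ => ?_
  have e1 : (i + j • g - l = -g) ↔ l = i + (j + 1) • g := by
    rw [succ_nsmul, ← add_assoc, sub_eq_iff_eq_add, neg_add_eq_sub, eq_sub_iff_add_eq, eq_comm]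
  have e2 : (i + j • g - l = 0) ↔ l = i + j • g := by
    rw [sub_eq_zero, eq_comm]
  simp only [e1, e2]

/-- A matrix pencil with nonzero extreme coefficients is singular at some nonzero point. -/
lemma exists_kernel (g : ι) [Nonempty ι] (k : ℕ) (d : ι → ℕ → ℂ) (h0 : ∀ i, d i 0 ≠ 0)
    (h1 : ∀ i, d i (k + 1) ≠ 0) :
    ∃ r : ℂ, r ≠ 0 ∧ ∃ u : ι → ℂ, u ≠ 0 ∧
      ∀ i, ∑ j ∈ Finset.range (k + 2), d i j * r ^ j * u (i + j • g) = 0 := by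
  -- The pencil is homogenized so that its behaviour at infinity is visible at `(1, 0)`, where only
  -- the top term survives.
  let A : ℂ → ℂ → Matrix ι ι ℂ := fun x y =>
    shiftPoly g (k + 2) fun i j => d i j * x ^ j * y ^ (k + 1 - j)
  have hA01 : (A 0 1).det ≠ 0 := by
    intro h
    obtain ⟨v, hv, hAv⟩ := exists_mulVec_eq_zero_iff.2 h
    refine hv (funext fun i => ?_)
    have := congrFun hAv i
    rw [shiftPoly_mulVec, Finset.sum_range_succ'] at this
    simpa [h0 i] using this
  have hA10 : (A 1 0).det ≠ 0 := by
    intro h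
    obtain ⟨v, hv, hAv⟩ := exists_mulVec_eq_zero_iff.2 h
    refine hv (funext fun i => ?_)
    have := congrFun hAv (i - (k + 1) • g)
    rw [shiftPoly_mulVec, Finset.sum_range_succ, Finset.sum_eq_zero] at this
    · simpa [h1] using this
    · intro j hj
      have : k + 1 - j ≠ 0 := by have := Finset.mem_range.1 hj; omega
      simp [this]
  let Q : Polynomial ℂ := Matrix.det (Matrix.of fun i l => ∑ j ∈ Finset.range (k + 2),
    Polynomial.C (d i j) * Polynomial.X ^ j * if l = i + j • g then 1 else 0)
  have hQ : ∀ x, Q.eval x = (A x 1).det := by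
    intro x
    rw [← Polynomial.coe_evalRingHom, RingHom.map_det]
    congr 1
    ext i l
    simp only [A, shiftPoly, RingHom.mapMatrix_apply, map_apply, of_apply,
      Polynomial.coe_evalRingHom, Polynomial.eval_finsetSum]
    refine Finset.sum_congr rfl fun j _ => ?_
    split_ifs <;> simp
  have hroot : ∃ r, Q.eval r = 0 := by
    by_contra! hno
    have hdeg : Q.degree = 0 := by
      by_contra hd
      obtain ⟨r, hr⟩ := IsAlgClosed.exists_root Q hd
      exact hno r hr
    obtain hc := Polynomial.eq_C_of_degree_eq_zero hdeg
    have hcont : Continuous fun y => (A 1 y).det := by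
      refine Continuous.matrix_det ((continuous_shiftPoly g (k + 2)).comp ?_)
      fun_prop
    have hscale : ∀ y : ℂ, y ≠ 0 →
        (A 1 y).det = (y ^ (k + 1)) ^ Fintype.card ι * Q.coeff 0 := by
      intro y hy
      have h2 : A 1 y = y ^ (k + 1) • A y⁻¹ 1 := by
        ext i l
        simp only [A, shiftPoly, Matrix.smul_apply, of_apply, smul_eq_mul, Finset.mul_sum]
        refine Finset.sum_congr rfl fun j hj => ?_
        have hj' : j ≤ k + 1 := by have := Finset.mem_range.1 hj; omega
        have : y ^ (k + 1) = y ^ (k + 1 - j) * y ^ j := by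
          rw [← pow_add]; congr 1; omega
        rw [this, inv_pow]
        have := pow_ne_zero j hy
        field_simp
        simp
      rw [h2, det_smul, ← hQ, hc]
      simp
    -- If `Q` were constant, homogeneity and continuity would force `det (A 1 y)` to vanish at `y =
    -- 0`, against `hA10`.
    have heq : (fun y => (A 1 y).det) =
        fun y : ℂ => (y ^ (k + 1)) ^ Fintype.card ι * Q.coeff 0 :=
      Continuous.ext_on (dense_compl_singleton (0 : ℂ)) hcont (by fun_prop)
        fun y hy => hscale y hy
    apply hA10
    have := congrFun heq 0
    simpa [Fintype.card_ne_zero] using this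
  obtain ⟨r, hr⟩ := hroot
  rw [hQ] at hr
  refine ⟨r, fun h => hA01 (h ▸ hr), ?_⟩
  obtain ⟨u, hu, hAu⟩ := exists_mulVec_eq_zero_iff.2 hr
  refine ⟨u, hu, fun i => ?_⟩
  have := congrFun hAu i
  rw [shiftPoly_mulVec] at this
  simpa using this

omit [Fintype ι] [DecidableEq ι] in
/-- A nonzero kernel vector has no long run of zeros. -/
lemma exists_ne_zero_of_kernel (g : ι) (hg : ∀ x : ι, ∃ j : ℕ, j • g = x) (k : ℕ)
    (d : ι → ℕ → ℂ) (h1 : ∀ i, d i (k + 1) ≠ 0) (r : ℂ) (hr : r ≠ 0) (u : ι → ℂ) (hu : u ≠ 0)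
    (h : ∀ i, ∑ j ∈ Finset.range (k + 2), d i j * r ^ j * u (i + j • g) = 0) (i : ι) :
    ∃ j ∈ Finset.range (k + 2), u (i + j • g) ≠ 0 := by
  by_contra! hz
  -- The kernel relation is a recurrence with nonzero leading coefficient, so a run of zeros
  -- propagates around the orbit of `g`.
  have key : ∀ m : ℕ, u (i + m • g) = 0 := by
    intro m
    induction m using Nat.strong_induction_on with
    | _ m ih =>
      by_cases hm : m < k + 2
      · exact hz m (Finset.mem_range.2 hm)
      · obtain ⟨p, rfl⟩ : ∃ p, m = p + (k + 1) := ⟨m - (k + 1), by omega⟩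
        have h2 := h (i + p • g)
        rw [Finset.sum_range_succ, Finset.sum_eq_zero, zero_add] at h2
        · rw [add_assoc, ← add_nsmul] at h2
          simpa [h1, hr] using h2
        · intro j hj
          have := Finset.mem_range.1 hj
          rw [add_assoc, ← add_nsmul, ih (p + j) (by omega), mul_zero]
  refine hu (funext fun l => ?_)
  obtain ⟨j, hj⟩ := hg (l - i)
  have := key j
  rwa [hj, add_sub_cancel] at this

lemma eventually_add_ne_zero (a : ℂ) : ∀ᶠ t in 𝓝[≠] (0 : ℂ), a + t ≠ 0 := by
  have : ∀ᶠ t in 𝓝[≠] (0 : ℂ), t ≠ -a := by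
    by_cases ha : (0 : ℂ) = -a
    · rw [← ha]; exact self_mem_nhdsWithin
    · exact eventually_ne_nhdsWithin ha
  filter_upwards [this] with t ht h
  exact ht (eq_neg_of_add_eq_zero_right h)

/-- The matrices that split off a factor `(P - r) diag(u)⁻¹` are dense among those of degree at
most `k + 1` with nonzero extreme coefficients. -/
lemma shiftPoly_mem_closure_of_ne_zero (g : ι) (hg : ∀ x : ι, ∃ j : ℕ, j • g = x) (k : ℕ)
    (d : ι → ℕ → ℂ) (h0 : ∀ i, d i 0 ≠ 0) (h1 : ∀ i, d i (k + 1) ≠ 0) :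
    shiftPoly g (k + 2) d ∈ closure {M | ∃ (s : ι → ℕ → ℂ) (c v : ι → ℂ),
      M = shiftPoly g (k + 1) s * circulant c * diagonal v} := by
  obtain ⟨r, hr, u, hu, hker⟩ := exists_kernel g k d h0 h1
  choose p hp hpu using exists_ne_zero_of_kernel g hg k d h1 r hr u hu hker
  let ρ : ι → ℂ → ℂ := fun i t =>
    ∑ j ∈ Finset.range (k + 2), d i j * r ^ j * (u (i + j • g) + t)
  -- Replacing `u` by `u + t` removes its zeros but leaves a residue `ρ i t` in row `i`. One
  -- coefficient absorbs it, at an index `p i` where `u` is nonzero, so the correction tends to `0`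
  -- with `t`.
  let d' : ℂ → ι → ℕ → ℂ := fun t i j =>
    d i j - if j = p i then ρ i t / (r ^ j * (u (i + j • g) + t)) else 0
  have hd'0 : d' 0 = d := by
    ext i j
    have : ρ i 0 = 0 := by simpa [ρ] using hker i
    simp [d', this]
  have hd' : Tendsto d' (𝓝[≠] 0) (𝓝 d) := by
    refine Tendsto.mono_left ?_ nhdsWithin_le_nhds
    suffices Tendsto d' (𝓝 0) (𝓝 (d' 0)) by rwa [hd'0] at this
    refine tendsto_pi_nhds.2 fun i => tendsto_pi_nhds.2 fun j => ?_
    by_cases hj : j = p i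
    · have : r ^ j * (u (i + j • g) + 0) ≠ 0 := by
        rw [hj, add_zero]
        exact mul_ne_zero (pow_ne_zero _ hr) (hpu i)
      have hc : ContinuousAt (fun t => d i j - ρ i t / (r ^ j * (u (i + j • g) + t))) 0 :=
        ContinuousAt.sub (by fun_prop) (ContinuousAt.div (by fun_prop) (by fun_prop) this)
      simpa only [d', hj, if_true] using hc.tendsto
    · simp only [d', hj, if_false]
      exact tendsto_const_nhds
  refine mem_closure_of_tendsto (((continuous_shiftPoly g (k + 2)).tendsto d).comp hd') ?_
  have hne : ∀ᶠ t in 𝓝[≠] (0 : ℂ), ∀ i, u i + t ≠ 0 :=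
    eventually_all.2 fun i => eventually_add_ne_zero (u i)
  filter_upwards [hne] with t ht
  obtain ⟨s, c, h⟩ := exists_shiftPoly_eq_mul g (k + 1) (d' t) r (fun i => u i + t) ht (by
    intro i
    have e : ∀ j ∈ Finset.range (k + 2), d' t i j * r ^ j * (u (i + j • g) + t) =
        d i j * r ^ j * (u (i + j • g) + t) - if j = p i then ρ i t else 0 := by
      intro j _
      simp only [d']
      split_ifs
      · have := pow_ne_zero j hr
        have := ht (i + j • g)
        field_simp
      · ring
    rw [Finset.sum_congr rfl e, Finset.sum_sub_distrib, Finset.sum_ite_eq', if_pos (hp i)]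
    exact sub_self _)
  exact ⟨s, c, _, h⟩

/-- The matrices that split off a factor `(P - r) diag(u)⁻¹` are dense among those of degree at
most `k + 1`. -/
lemma shiftPoly_mem_closure_factor (g : ι) (hg : ∀ x : ι, ∃ j : ℕ, j • g = x) (k : ℕ)
    (d : ι → ℕ → ℂ) :
    shiftPoly g (k + 2) d ∈ closure {M | ∃ (s : ι → ℕ → ℂ) (c v : ι → ℂ),
      M = shiftPoly g (k + 1) s * circulant c * diagonal v} := by
  have hd : Tendsto (fun (t : ℂ) i j => d i j + t) (𝓝[≠] 0) (𝓝 d) := by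
    refine Tendsto.mono_left ?_ nhdsWithin_le_nhds
    have : Continuous fun (t : ℂ) i j => d i j + t := by fun_prop
    simpa using this.tendsto 0
  rw [← closure_closure]
  refine mem_closure_of_tendsto (((continuous_shiftPoly g (k + 2)).tendsto d).comp hd) ?_
  have h0 := eventually_all.2 fun i => eventually_add_ne_zero (d i 0)
  have h1 := eventually_all.2 fun i => eventually_add_ne_zero (d i (k + 1))
  filter_upwards [h0, h1] with t ht0 ht1
  exact shiftPoly_mem_closure_of_ne_zero g hg k _ ht0 ht1

/-- Induction on the degree: multiplication by the two split-off factors is continuous, so it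
carries the closure for degree `k` into the closure for degree `k + 1`. -/
lemma shiftPoly_mem_closure (g : ι) (hg : ∀ x : ι, ∃ j : ℕ, j • g = x) (k : ℕ)
    (d : ι → ℕ → ℂ) :
    shiftPoly g (k + 1) d ∈ closure (diagCirc ι ^ (2 * k + 1)) := by
  induction k generalizing d with
  | zero =>
    apply subset_closure
    have : shiftPoly g 1 d = diagonal fun i => d i 0 := by
      ext i l
      simp [shiftPoly, diagonal_apply, eq_comm]
    simpa [this] using diagonal_mem_diagCirc _
  | succ k ih =>
    refine closure_minimal ?_ isClosed_closure (shiftPoly_mem_closure_factor g hg k d)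
    rintro M ⟨s, c, v, rfl⟩
    refine map_mem_closure (f := fun B => B * circulant c * diagonal v) 
      ((continuous_id.matrix_mul continuous_const).matrix_mul continuous_const) (ih s) ?_
    intro B hB
    rw [show 2 * (k + 1) + 1 = 2 * k + 1 + 1 + 1 by ring, pow_succ, pow_succ]
    exact Set.mul_mem_mul (Set.mul_mem_mul hB (circulant_mem_diagCirc c))
      (diagonal_mem_diagCirc v)

end Cyclic

/-- Products of `2 n - 1` diagonal-circulant matrices are dense in the `n × n` matrices. -/
theorem mem_closure_diagCirc_pow (m : ℕ) (A : Matrix (Fin (m + 1)) (Fin (m + 1)) ℂ) :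
    A ∈ closure (diagCirc (Fin (m + 1)) ^ (2 * m + 1)) := by
  have hg : ∀ x : Fin (m + 1), (x : ℕ) • (1 : Fin (m + 1)) = x := by
    have h : ∀ k : ℕ, ((k • (1 : Fin (m + 1)) : Fin (m + 1)) : ℕ) = k % (m + 1) := by
      intro k
      induction k with
      | zero => simp
      | succ k ih => rw [succ_nsmul, Fin.val_add, ih, Fin.val_one', ← Nat.add_mod]
    intro x
    ext
    rw [h, Nat.mod_eq_of_lt x.isLt]
  -- For fixed `i`, the index `i + j • 1` runs once through all columns as `j < m + 1` varies.
  have hA : A = shiftPoly 1 (m + 1) fun i j => A i (i + j • 1) := by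
    ext i l
    simp only [shiftPoly, of_apply]
    rw [Finset.sum_range (fun j => A i (i + j • (1 : Fin (m + 1))) * if l = i + j • (1 : Fin (m + 1)) then 1 else 0)]
    simp only [hg]
    rw [Fintype.sum_eq_single (l - i)]
    · simp
    · intro x hx
      rw [if_neg, mul_zero]
      rintro rfl
      simp at hx
  rw [hA]
  exact shiftPoly_mem_closure (1 : Fin (m + 1)) (fun x => ⟨(x : ℕ), hg x⟩) m _


/-! ### From matrices to networks -/

variable {n : ℕ}

lemma norm_cReLU_sub_le (z w : ℂ) : ‖cReLU z - cReLU w‖ ≤ ‖z - w‖ := by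
  have key : ∀ a b : ℝ, (max 0 a - max 0 b) * (max 0 a - max 0 b) ≤ (a - b) * (a - b) :=
    fun a b => by
      have := abs_max_sub_max_le_max 0 a 0 b
      simp only [sub_self, abs_zero] at this
      rw [max_eq_right (abs_nonneg (a - b))] at this
      exact abs_le_iff_mul_self_le.1 this
  rw [Complex.norm_def, Complex.norm_def]
  refine Real.sqrt_le_sqrt ?_
  rw [Complex.normSq_apply, Complex.normSq_apply]
  exact add_le_add (key z.re w.re) (key z.im w.im)

lemma norm_layer_sub_layer_le (W W' : Matrix (Fin n) (Fin n) ℂ) (b x x' : Vec n) :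
    ‖layer cReLU W b x - layer cReLU W' b x'‖ ≤
      ‖toEuclideanCLM (𝕜 := ℂ) W x - toEuclideanCLM (𝕜 := ℂ) W' x'‖ := by
  rw [EuclideanSpace.norm_eq, EuclideanSpace.norm_eq]
  refine Real.sqrt_le_sqrt (Finset.sum_le_sum fun t _ => ?_)
  gcongr
  refine (norm_cReLU_sub_le _ _).trans_eq ?_
  simp [ofLp_toEuclideanCLM]

lemma isDCNN_zero : IsDCNN 0 (id : Vec n → Vec n) :=
  ⟨Fin.elim0, Fin.elim0, Fin.elim0, Fin.elim0, fun i => i.elim0, fun i => i.elim0,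
    fun i => i.elim0, rfl⟩

lemma IsDCNN.layer_comp {m : ℕ} {N : Vec n → Vec n} (hN : IsDCNN m N)
    {D C : Matrix (Fin n) (Fin n) ℂ} (hD : D.IsDiag) (hC : IsCirculant C) (b : Vec n)
    {φ : ℂ → ℂ} (hφ : φ = cReLU ∨ φ = id) : IsDCNN (m + 1) (layer φ (D * C) b ∘ N) := by
  obtain ⟨Ds, Cs, bs, φs, hDs, hCs, hφs, rfl⟩ := hN
  refine ⟨Fin.snoc (α := fun _ => Matrix (Fin n) (Fin n) ℂ) Ds D,
    Fin.snoc (α := fun _ => Matrix (Fin n) (Fin n) ℂ) Cs C, Fin.snoc (α := fun _ => Vec n) bs b,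
    Fin.snoc (α := fun _ => ℂ → ℂ) φs φ, fun i => ?_, fun i => ?_, fun i => ?_, ?_⟩
  · refine Fin.lastCases ?_ (fun i => ?_) i
    · simpa using hD
    · simpa using hDs i
  · refine Fin.lastCases ?_ (fun i => ?_) i
    · simpa using hC
    · simpa using hCs i
  · refine Fin.lastCases ?_ (fun i => ?_) i
    · simpa using hφ
    · simpa using hφs i
  · simp [compLayers]

lemma IsDCNN.comp {m k : ℕ} {N N' : Vec n → Vec n} (hN' : IsDCNN k N') (hN : IsDCNN m N) :
    IsDCNN (m + k) (N' ∘ N) := by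
  induction k generalizing N' with
  | zero =>
    obtain ⟨_, _, _, _, _, _, _, rfl⟩ := hN'
    exact hN
  | succ k ih =>
    obtain ⟨D, C, b, φ, hD, hC, hφ, rfl⟩ := hN'
    exact (ih ⟨fun i => D i.castSucc, fun i => C i.castSucc, fun i => b i.castSucc,
      fun i => φ i.castSucc, fun i => hD _, fun i => hC _, fun i => hφ _, rfl⟩).layer_comp
      (hD (Fin.last k)) (hC _) (b _) (hφ _)

lemma isDCNN_layer {m : ℕ} {M : Matrix (Fin (n + 1)) (Fin (n + 1)) ℂ}
    (hM : M ∈ diagCirc (Fin (n + 1)) ^ (m + 1)) (b : Vec (n + 1)) {φ : ℂ → ℂ}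
    (hφ : φ = cReLU ∨ φ = id) : IsDCNN (m + 1) (layer φ M b) := by
  induction m generalizing M b φ with
  | zero =>
    rw [zero_add, pow_one] at hM
    obtain ⟨d, c, rfl⟩ := hM
    exact isDCNN_zero.layer_comp (isDiag_diagonal d) ⟨c, rfl⟩ b hφ
  | succ m ih =>
    rw [pow_succ'] at hM
    obtain ⟨_, ⟨d, c, rfl⟩, B, hB, rfl⟩ := hM
    -- All factors but the outermost become layers with zero bias and identity activation.
    have := (ih hB 0 (Or.inr rfl)).layer_comp (isDiag_diagonal d) ⟨c, rfl⟩ b hφ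
    convert this using 1
    funext x
    simp [layer, mulVec_mulVec]

/-- A deep ReLU network of width `n + 1` maps bounded sets to bounded sets, and on each of them it
is uniformly approximated by diagonal circulant networks. -/
lemma exists_isDCNN_approx (L : ℕ) {N : Vec (n + 1) → Vec (n + 1)} (hN : IsDeepReLUNetwork L N)
    {X : Set (Vec (n + 1))} (hX : Bornology.IsBounded X) :
    Bornology.IsBounded (N '' X) ∧ ∀ ε > 0, ∃ N', IsDCNN ((2 * n + 1) * L) N' ∧
      ∀ x ∈ X, ‖N x - N' x‖ < ε := by
  induction L generalizing N with
  | zero =>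
    obtain ⟨W, b, rfl⟩ := hN
    exact ⟨by simpa [compLayers] using hX,
      fun ε hε => ⟨id, isDCNN_zero, fun x _ => by simpa [compLayers] using hε⟩⟩
  | succ L ih =>
    obtain ⟨W, b, rfl⟩ := hN
    obtain ⟨hb, happ⟩ := ih ⟨fun i => W i.castSucc, fun i => b i.castSucc, rfl⟩
    simp only [compLayers]
    generalize compLayers L (fun i => layer cReLU (W i.castSucc) (b i.castSucc)) = N₀ at hb happ
    generalize W (Fin.last L) = A
    generalize b (Fin.last L) = v
    constructor
    · rw [Set.image_comp]
      have hlip : LipschitzWith ‖toEuclideanCLM (𝕜 := ℂ) A‖₊ (layer cReLU A v) :=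
        LipschitzWith.of_dist_le_mul fun x y => by
          rw [dist_eq_norm, dist_eq_norm]
          refine (norm_layer_sub_layer_le _ _ _ _ _).trans ?_
          rw [← map_sub]
          exact ContinuousLinearMap.le_opNorm _ _
      exact hlip.isBounded_image hb
    · intro ε hε
      obtain ⟨R, hR, hRb⟩ := hb.exists_pos_norm_le
      set K := ‖toEuclideanCLM (𝕜 := ℂ) A‖ with hK
      have hK0 : 0 ≤ K := norm_nonneg _
      -- The bound `1` keeps `N₁ x` in the ball of radius `R + 1`; the other bound makes the error
      -- amplified by `A` at most `ε / 2`.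
      obtain ⟨N₁, hN₁, hN₁app⟩ := happ (min 1 (ε / (2 * (K + 1)))) (by positivity)
      obtain ⟨B, hB, hBA⟩ : ∃ B ∈ diagCirc (Fin (n + 1)) ^ (2 * n + 1),
          ‖toEuclideanCLM (𝕜 := ℂ) A - toEuclideanCLM (𝕜 := ℂ) B‖ < ε / (2 * (R + 1)) := by
        have hc : Continuous fun M : Matrix (Fin (n + 1)) (Fin (n + 1)) ℂ =>
            toEuclideanCLM (𝕜 := ℂ) M :=
          LinearMap.continuous_of_finiteDimensional
            (toEuclideanCLM (n := Fin (n + 1)) (𝕜 := ℂ)).toAlgEquiv.toLinearMap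
        obtain ⟨_, ⟨B, hB, rfl⟩, h⟩ := Metric.mem_closure_iff.1
          (map_mem_closure hc (mem_closure_diagCirc_pow n A) (Set.mapsTo_image _ _))
          (ε / (2 * (R + 1))) (by positivity)
        exact ⟨B, hB, by rwa [dist_eq_norm] at h⟩
      refine ⟨layer cReLU B v ∘ N₁, ?_, fun x hx => ?_⟩
      · rw [mul_add, mul_one]
        exact (isDCNN_layer hB v (Or.inl rfl)).comp hN₁
      · have h1 := hN₁app x hx
        have h2 := hRb _ (Set.mem_image_of_mem N₀ hx)
        have h3 : ‖N₁ x‖ ≤ R + 1 := by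
          have := norm_sub_norm_le (N₁ x) (N₀ x)
          rw [norm_sub_rev] at this
          linarith [h1.trans_le (min_le_left _ _)]
        have h4 : K * ‖N₀ x - N₁ x‖ ≤ ε / 2 := by
          calc K * ‖N₀ x - N₁ x‖ ≤ (K + 1) * (ε / (2 * (K + 1))) := by
                gcongr
                · linarith
                · exact h1.le.trans (min_le_right _ _)
            _ = ε / 2 := by field_simp
        have h5 : ‖toEuclideanCLM (𝕜 := ℂ) A - toEuclideanCLM (𝕜 := ℂ) B‖ * ‖N₁ x‖ < ε / 2 := by
          calc _ ≤ ‖toEuclideanCLM (𝕜 := ℂ) A - toEuclideanCLM (𝕜 := ℂ) B‖ * (R + 1) := by gcongr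
            _ < ε / (2 * (R + 1)) * (R + 1) := by gcongr
            _ = ε / 2 := by field_simp
        refine (norm_layer_sub_layer_le A B v (N₀ x) (N₁ x)).trans_lt ?_
        -- The error splits into the inherited one, amplified by `A`, and the one from replacing `A`
        -- by `B` on a bounded set.
        have h6 : toEuclideanCLM (𝕜 := ℂ) A (N₀ x) - toEuclideanCLM (𝕜 := ℂ) B (N₁ x) =
            toEuclideanCLM (𝕜 := ℂ) A (N₀ x - N₁ x) +
              (toEuclideanCLM (𝕜 := ℂ) A - toEuclideanCLM (𝕜 := ℂ) B) (N₁ x) := by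
          rw [map_sub, _root_.sub_apply]
          abel
        rw [h6]
        refine (norm_add_le _ _).trans_lt ?_
        have h7 := (toEuclideanCLM (𝕜 := ℂ) A).le_opNorm (N₀ x - N₁ x)
        have h8 := (toEuclideanCLM (𝕜 := ℂ) A - toEuclideanCLM (𝕜 := ℂ) B).le_opNorm (N₁ x)
        linarith

end DCNN

theorem lemma1 (n L : ℕ) (hn : 1 ≤ n)
    (N : DCNN.Vec n → DCNN.Vec n) (hN : DCNN.IsDeepReLUNetwork L N)
    (X : Set (DCNN.Vec n)) (hX : Bornology.IsBounded X)
    (ε : ℝ) (hε : 0 < ε) :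
    ∃ N' : DCNN.Vec n → DCNN.Vec n,
      DCNN.IsDCNN ((2 * n - 1) * L) N' ∧ ∀ x ∈ X, ‖N x - N' x‖ < ε := by
  obtain ⟨m, rfl⟩ : ∃ m, n = m + 1 := ⟨n - 1, by omega⟩
  exact (DCNN.exists_isDCNN_approx L hN hX).2 ε hε
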